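/- Let $d\ge 1$. An axis-aligned strip in $\mathbb{R}^d$ is a set $\{x\in\mathbb{R}^d : a\le x_i\le b\}$ with $i\in\{1,\dots,d\}$ and $a,b\in\mathbb{R}$. For a finite set $V\subset\mathbb{R}^d$ in general position (no two points of $V$ agree in any coordinate) and a positive integer $m$, let $\mathcal{H}(V,m)$ be the hypergraph with vertex set $V$ whose hyperedges are the subsets $e\subseteq V$ with $|e|=m$ and $e=V\cap R$ for some axis-aligned strip $R$. A coloring of $V$ with $k$ colors is polychromatic for $\mathcal{H}(V,m)$ if every hyperedge contains points of all $k$ colors. Let $m_d(k)$ be the smallest positive integer $m$ such that for every finite $V\subset\mathbb{R}^d$ in general position, $\mathcal{H}(V,m)$ has a polychromatic coloring with $k$ colors ($m_d(k)=\infty$ if there is no such $m$). Then there is a function $f:\mathbb{N}\to\mathbb{R}$ with $f(d)\to 0$ as $d\to\infty$ such that for all integers $d\ge 1$ and $k\ge 2$, $m_d(k)$ is finite and $$m_d(k)\le 3\mathrm{e}\,d\,(1+f(d))\,k .$$ -/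

import Mathlib

namespace PolychromaticStrips

/-- The hyperedges of the `m`-uniform range capturing hypergraph with vertex set `V` and
range family `R`: the `m`-element subsets `e` of `V` of the form `e = V ∩ r` with `r ∈ R`. -/
def rangeEdges {α : Type*} (V : Finset α) (R : Set (Set α)) (m : ℕ) : Set (Finset α) :=
  {e | e ⊆ V ∧ e.card = m ∧ ∃ r ∈ R, (e : Set α) = (V : Set α) ∩ r}

/-- A `k`-coloring `c` of `V` is polychromatic for a set `E` of hyperedges if every hyperedge
contains a vertex of each of the `k` colors. -/
def IsPolychromatic {α : Type*} {V : Finset α} {k : ℕ} (E : Set (Finset α))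
    (c : V → Fin k) : Prop :=
  ∀ e ∈ E, ∀ x : Fin k, ∃ v : V, (v : α) ∈ e ∧ c v = x

/-- A finite point set is in general position if no two of its points share a coordinate. -/
def GeneralPosition {d : ℕ} (V : Finset (Fin d → ℝ)) : Prop :=
  ∀ p ∈ V, ∀ q ∈ V, p ≠ q → ∀ i, p i ≠ q i

/-- `m_R(k)`: the least positive integer `m` such that for every finite point set `V` (in general
position) the `m`-uniform range capturing hypergraph of `V` and `R` has a polychromatic
`k`-coloring; it is `⊤` if there is no such `m`. -/
noncomputable def mRange {d : ℕ} (R : Set (Set (Fin d → ℝ))) (k : ℕ) : ℕ∞ :=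
  sInf ((fun m : ℕ => (m : ℕ∞)) '' {m : ℕ | 1 ≤ m ∧
    ∀ V : Finset (Fin d → ℝ), GeneralPosition V →
      ∃ c : V → Fin k, IsPolychromatic (rangeEdges V R m) c})

/-- The family of all axis-aligned strips `{x | a ≤ x i ≤ b}` in `ℝ^d`. -/
def strips (d : ℕ) : Set (Set (Fin d → ℝ)) :=
  {s | ∃ (i : Fin d) (a b : ℝ), s = {x | a ≤ x i ∧ x i ≤ b}}

/-- `m_d(k)`, the value of `m_R(k)` for the axis-aligned strips in `ℝ^d`. -/
noncomputable def mStrips (d k : ℕ) : ℕ∞ := mRange (strips d) k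

end PolychromaticStrips

namespace PolychromaticStrips

/-! Cut `V`, in each of the `d` coordinate orders, into blocks of `d * k` consecutive points. A
point lies in one block per order, hence in at most `d * k` (block, color) pairs, while each pair
offers at least `d * k` points. Hall's theorem then gives the pairs distinct representatives, which
are colored accordingly (`exists_coloring_blockIn`). A strip with `2 * (d * k) - 1` points contains
a full block (`exists_blockIn_subset`), so it sees every color. -/

/-- The number of points of `V` that `g` places strictly before `p`. -/
noncomputable def rankIn {α : Type*} (V : Finset α) (g : α → ℝ) (p : α) : ℕ :=
  (V.filter fun q => g q < g p).card

/-- The `j`-th block of `s` consecutive points of `V` in the order given by `g`. -/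
noncomputable def blockIn {α : Type*} (V : Finset α) (g : α → ℝ) (s j : ℕ) : Finset α :=
  V.filter fun p => rankIn V g p / s = j

section Rank

variable {α : Type*} {V : Finset α} {g : α → ℝ}

lemma rankIn_lt_rankIn {p q : α} (hp : p ∈ V) (h : g p < g q) :
    rankIn V g p < rankIn V g q := by
  refine Finset.card_lt_card ⟨fun x hx => ?_, fun hsub => ?_⟩
  · rw [Finset.mem_filter] at hx ⊢
    exact ⟨hx.1, hx.2.trans h⟩
  · exact lt_irrefl _ (Finset.mem_filter.1 (hsub (Finset.mem_filter.2 ⟨hp, h⟩))).2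

lemma rankIn_lt_card {p : α} (hp : p ∈ V) : rankIn V g p < V.card := by
  refine Finset.card_lt_card ⟨Finset.filter_subset _ _, fun hsub => ?_⟩
  exact lt_irrefl _ (Finset.mem_filter.1 (hsub hp)).2

lemma rankIn_injOn (hg : Set.InjOn g V) : Set.InjOn (rankIn V g) V := by
  intro p hp q hq h
  rcases lt_trichotomy (g p) (g q) with hlt | heq | hlt
  · exact absurd h (rankIn_lt_rankIn hp hlt).ne
  · exact hg hp hq heq
  · exact absurd h (rankIn_lt_rankIn hq hlt).ne'

lemma image_rankIn (hg : Set.InjOn g V) : V.image (rankIn V g) = Finset.range V.card := by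
  refine Finset.eq_of_subset_of_card_le (fun r hr => ?_) ?_
  · obtain ⟨p, hp, rfl⟩ := Finset.mem_image.1 hr
    exact Finset.mem_range.2 (rankIn_lt_card hp)
  · rw [Finset.card_range, Finset.card_image_of_injOn (rankIn_injOn hg)]

/-- Ranks fill an initial segment of `ℕ` without gaps; the bound on `j` discards a possibly
incomplete last block. -/
lemma le_card_blockIn (hg : Set.InjOn g V) {s j : ℕ} (hj : j < V.card / s) :
    s ≤ (blockIn V g s j).card := by
  have hs : 0 < s := Nat.pos_of_ne_zero fun h => by simp [h] at hj
  have hle : s * (j + 1) ≤ V.card := (Nat.mul_le_mul_left s hj).trans (Nat.mul_div_le _ _)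
  calc s = (Finset.Ico (s * j) (s * (j + 1))).card := by
        rw [Nat.card_Ico, mul_add, mul_one, Nat.add_sub_cancel_left]
    _ ≤ ((blockIn V g s j).image (rankIn V g)).card := by
        refine Finset.card_le_card fun r hr => ?_
        rw [Finset.mem_Ico] at hr
        have hr' : r ∈ V.image (rankIn V g) := by
          rw [image_rankIn hg, Finset.mem_range]
          exact hr.2.trans_le hle
        obtain ⟨p, hp, rfl⟩ := Finset.mem_image.1 hr'
        refine Finset.mem_image_of_mem _ (Finset.mem_filter.2 ⟨hp, ?_⟩)
        exact Nat.div_eq_of_lt_le (by rw [mul_comm]; exact hr.1) (by rw [mul_comm]; exact hr.2)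
    _ ≤ (blockIn V g s j).card := Finset.card_image_le

/-- Every interval of `2s - 1` points contains a complete block of `s` points. -/
lemma exists_blockIn_subset {s : ℕ} (hs : 0 < s) {a b : ℝ}
    (hcard : (V.filter fun p => a ≤ g p ∧ g p ≤ b).card = 2 * s - 1) :
    ∃ j < V.card / s, blockIn V g s j ⊆ V.filter fun p => a ≤ g p ∧ g p ≤ b := by
  classical
  set e := V.filter fun p => a ≤ g p ∧ g p ≤ b with he
  set L := V.filter fun p => g p < a with hL
  have hdisj : Disjoint L e := by
    rw [Finset.disjoint_left]
    intro p hp hp'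
    exact absurd (Finset.mem_filter.1 hp).2 (not_lt.2 (Finset.mem_filter.1 hp').2.1)
  have hunion : (L ∪ e).card = L.card + (2 * s - 1) := by
    rw [Finset.card_union_of_disjoint hdisj, hcard]
  have hV : L.card + (2 * s - 1) ≤ V.card := by
    rw [← hunion]
    exact Finset.card_le_card
      (Finset.union_subset (Finset.filter_subset _ _) (Finset.filter_subset _ _))
  -- Rounding `L.card / s` up picks the first block starting no earlier than the interval; it starts
  -- at most `s - 1` ranks later, so it also ends inside.
  set j := (L.card + (s - 1)) / s with hj
  have h1 : s * j ≤ L.card + (s - 1) := Nat.mul_div_le _ _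
  have h2 : L.card + (s - 1) < s * (j + 1) := Nat.lt_mul_div_succ _ hs
  rw [mul_add, mul_one] at h2
  refine ⟨j, ?_, fun p hp => ?_⟩
  · rw [← Nat.succ_le_iff, Nat.le_div_iff_mul_le hs, Nat.succ_eq_add_one, mul_comm, mul_add,
      mul_one]
    omega
  · obtain ⟨hpV, hpj⟩ := Finset.mem_filter.1 hp
    have h3 : s * j ≤ rankIn V g p := hpj ▸ Nat.mul_div_le _ _
    have h4 : rankIn V g p < s * (j + 1) := hpj ▸ Nat.lt_mul_div_succ _ hs
    rw [mul_add, mul_one] at h4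
    refine Finset.mem_filter.2 ⟨hpV, ?_, ?_⟩
    · by_contra! hlt
      have : rankIn V g p < L.card := by
        refine Finset.card_lt_card ⟨fun q hq => ?_, fun hsub => ?_⟩
        · rw [Finset.mem_filter] at hq
          exact Finset.mem_filter.2 ⟨hq.1, hq.2.trans hlt⟩
        · exact lt_irrefl _ (Finset.mem_filter.1 (hsub (Finset.mem_filter.2 ⟨hpV, hlt⟩))).2
      omega
    · by_contra! hlt
      have hab : a ≤ b := by
        obtain ⟨q, hq⟩ : e.Nonempty := Finset.card_pos.1 (by omega)
        have := (Finset.mem_filter.1 hq).2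
        exact this.1.trans this.2
      -- A point beyond `b` is preceded by all of `L` and `e`, so its rank is too large for block
      -- `j`.
      have : (L ∪ e).card ≤ rankIn V g p := by
        refine Finset.card_le_card fun q hq => ?_
        rcases Finset.mem_union.1 hq with hq | hq
        · obtain ⟨hqV, hqa⟩ := Finset.mem_filter.1 hq
          exact Finset.mem_filter.2 ⟨hqV, (hqa.trans_le hab).trans hlt⟩
        · obtain ⟨hqV, -, hqb⟩ := Finset.mem_filter.1 hq
          exact Finset.mem_filter.2 ⟨hqV, hqb.trans_lt hlt⟩
      omega

end Rank

/-- Given `d` linear orders on `V`, all blocks of `dk` consecutive points can be made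
polychromatic at once: by Hall's theorem each pair of a block and a color gets its own point. -/
lemma exists_coloring_blockIn {α : Type*} {d k : ℕ} (hd : 0 < d) (hk : 0 < k) (V : Finset α)
    (g : Fin d → α → ℝ) (hg : ∀ i, Set.InjOn (g i) V) :
    ∃ c : V → Fin k, ∀ i, ∀ j < V.card / (d * k), ∀ x : Fin k,
      ∃ v : V, (v : α) ∈ blockIn V (g i) (d * k) j ∧ c v = x := by
  classical
  set s := d * k with hs
  have hs0 : 0 < s := Nat.mul_pos hd hk
  let t : Fin d × Fin (V.card / s) × Fin k → Finset α := fun y => blockIn V (g y.1) s y.2.1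
  obtain ⟨f, hf, hft⟩ := (Finset.all_card_le_biUnion_card_iff_exists_injective t).1 (by
    intro S
    -- Hall's condition by double counting incidences between pairs and points.
    refine Nat.le_of_mul_le_mul_right (c := s) ?_ hs0
    refine Finset.card_mul_le_card_mul (fun y p => p ∈ t y) (fun y hy => ?_) (fun p _ => ?_)
    · refine (le_card_blockIn (hg y.1) y.2.1.2).trans (Finset.card_le_card fun p hp => ?_)
      exact (Finset.mem_bipartiteAbove _).2 ⟨Finset.mem_biUnion.2 ⟨y, hy, hp⟩, hp⟩
    · have hinj : Set.InjOn (fun y : Fin d × Fin (V.card / s) × Fin k => (y.1, y.2.2))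
          (Finset.bipartiteBelow (fun y p => p ∈ t y) S p : Finset _) := by
        rintro ⟨i, j, x⟩ hy ⟨i', j', x'⟩ hy' h
        obtain ⟨h0, h0'⟩ := Prod.mk.inj h
        dsimp only at h0 h0'
        subst h0 h0'
        have h1 := (Finset.mem_filter.1 ((Finset.mem_bipartiteBelow _).1 hy).2).2
        have h2 := (Finset.mem_filter.1 ((Finset.mem_bipartiteBelow _).1 hy').2).2
        obtain rfl : j = j' := Fin.ext (h1.symm.trans h2)
        rfl
      rw [← Finset.card_image_of_injOn hinj]
      exact (Finset.card_le_univ _).trans_eq (by simp [hs]))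
  -- Points representing no pair get an arbitrary color.
  refine ⟨fun v => if h : ∃ y, f y = v then h.choose.2.2 else ⟨0, hk⟩, fun i j hj x => ?_⟩
  have hmem : f (i, ⟨j, hj⟩, x) ∈ blockIn V (g i) s j := hft (i, ⟨j, hj⟩, x)
  refine ⟨⟨f (i, ⟨j, hj⟩, x), (Finset.mem_filter.1 hmem).1⟩, hmem, ?_⟩
  have h : ∃ y, f y = f (i, ⟨j, hj⟩, x) := ⟨_, rfl⟩
  exact (dif_pos h).trans (congrArg (fun y => y.2.2) (hf h.choose_spec))

lemma exists_isPolychromatic_strips {d k : ℕ} (hd : 0 < d) (hk : 0 < k)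
    (V : Finset (Fin d → ℝ)) (hV : GeneralPosition V) :
    ∃ c : V → Fin k, IsPolychromatic (rangeEdges V (strips d) (2 * (d * k) - 1)) c := by
  have hg : ∀ i : Fin d, Set.InjOn (fun p : Fin d → ℝ => p i) V := fun i p hp q hq h => by
    by_contra hne
    exact hV p hp q hq hne i h
  obtain ⟨c, hc⟩ := exists_coloring_blockIn hd hk V (fun i p => p i) hg
  refine ⟨c, ?_⟩
  rintro e ⟨-, hcard, r, ⟨i, a, b, rfl⟩, he⟩ x
  have he' : e = V.filter fun p => a ≤ p i ∧ p i ≤ b := by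
    rw [← Finset.coe_inj, he, Finset.coe_filter]
    rfl
  rw [he'] at hcard ⊢
  obtain ⟨j, hj, hsub⟩ :=
    exists_blockIn_subset (g := fun p : Fin d → ℝ => p i) (Nat.mul_pos hd hk) hcard
  obtain ⟨v, hv, hvx⟩ := hc i j hj x
  exact ⟨v, hsub hv, hvx⟩

theorem mStrips_le {d k : ℕ} (hd : 0 < d) (hk : 0 < k) :
    mStrips d k ≤ ((2 * (d * k) - 1 : ℕ) : ℕ∞) := by
  have hs : 0 < d * k := Nat.mul_pos hd hk
  exact sInf_le ⟨_, ⟨by omega, exists_isPolychromatic_strips hd hk⟩, rfl⟩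

end PolychromaticStrips

theorem mainTheorem9 :
    ∃ f : ℕ → ℝ, Filter.Tendsto f Filter.atTop (nhds 0) ∧
      ∀ d : ℕ, 1 ≤ d → ∀ k : ℕ, 2 ≤ k →
        ∃ m : ℕ, PolychromaticStrips.mStrips d k = (m : ℕ∞) ∧
          (m : ℝ) ≤ 3 * Real.exp 1 * (d : ℝ) * (1 + f d) * (k : ℝ) := by
  -- No error term is needed, as `2 ≤ 3e`.
  refine ⟨fun _ => 0, tendsto_const_nhds, fun d hd k hk => ?_⟩
  have hle := PolychromaticStrips.mStrips_le hd (zero_lt_two.trans_le hk)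
  obtain ⟨m, hm⟩ := ENat.ne_top_iff_exists.1 (ne_top_of_le_ne_top (ENat.natCast_ne_top _) hle)
  refine ⟨m, hm.symm, ?_⟩
  rw [← hm, Nat.cast_le] at hle
  have hm2 : (m : ℝ) ≤ 2 * (d * k) := by exact_mod_cast hle.trans (Nat.sub_le _ _)
  have he : (1 : ℝ) ≤ Real.exp 1 := Real.one_le_exp zero_le_one
  have hdk : (0 : ℝ) ≤ d * k := by positivity
  calc (m : ℝ) ≤ 2 * (d * k) := hm2
    _ ≤ 3 * Real.exp 1 * (d * k) := mul_le_mul_of_nonneg_right (by linarith) hdk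
    _ = 3 * Real.exp 1 * d * (1 + 0) * k := by ring
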